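/- Let $p\ge 5$ be a prime. Let $\mathcal B$ be the group of continuous characters $\kappa:\mathbb Z_p^\times\to\mathbb C_p^\times$ that are trivial on the $(p-1)$st roots of unity, and put $w(\kappa):=\kappa(1+p)-1$. For $\kappa\in\mathcal B\setminus\{1\}$ let $$E^*_\kappa = 1+\frac{2}{\zeta^*(\kappa)}\sum_{n\ge 1}\Big(\sum_{d\mid n,\ p\nmid d}\kappa(d)d^{-1}\Big)q^n\in\mathbb C_p[[q]],$$ where $\zeta^*$ is the $p$-adic zeta function, $$\zeta^*(\kappa)=\frac{1}{\kappa(c)-1}\int_{\mathbb Z_p^\times}\kappa(x)x^{-1}\,dE_{1,c}(x),\qquad c=1+p,$$ with $E_{1,c}(a+p^n\mathbb Z_p)=B_1(\{a/p^n\})-c\,B_1(\{c^{-1}a/p^n\})$, $B_1(x)=x-\tfrac12$, where for an integer $a$ the fractional part $\{c^{-1}a/p^n\}$ means $r/p^n$ with $0\le r<p^n$, $cr\equiv a \pmod{p^n}$ (so that $\zeta^*(x\mapsto x^k)=(1-p^{k-1})\zeta(1-k)$ for positive integers $k$ divisible by $p-1$). Let $V$ be the operator $q\mapsto q^p$ on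 power series. Let $E_k$ denote the level one Eisenstein series of weight $k$ with constant term $1$, and $\Delta=q\prod_{m\ge1}(1-q^m)^{24}$. For even $n\ge 0$ let $d_n$ be the dimension of the space of modular forms of weight $n$ and level one, i.e. $d_n=\lfloor n/12\rfloor+1$ if $n\not\equiv 2 \pmod{12}$ and $d_n=\lfloor n/12\rfloor$ otherwise; let $\epsilon(k)=0$ if $k\equiv 0\pmod 4$ and $\epsilon(k)=1$ if $k\equiv 2\pmod 4$. Put $B_0(\mathbb Z_p)=\mathbb Z_p$, and for $i>0$ let $B_i(\mathbb Z_p)\subset\mathbb Z_p[[q]]$ be the $\mathbb Z_p$-module spanned by the forms $$g_{i,j}=\Delta^jE_4^aE_6^{\epsilon(i(p-1))},\qquad a=\frac{i(p-1)-12j-6\epsilon(i(p-1))}{4},\qquad d_{(i-1)(p-1)}\le j\le d_{i(p-1)}-1 .$$ Let $b_{i,j}\in B_i(\mathbb Z_p)$, $i,j\ge 0$, be the coefficients of the formal Katz expansion of $E^*_\kappa/V(E^*_\kappa)$ with respect to this (Lauder's) splitting; that is, for every $\kappa\in\mathcal B\setminus\{1\}$, $$\frac{E^*_\kappa}{V(E^*_\kappa)}=\sum_{i=0}^\infty\frac{\beta_i(w(\kappa))}{E_{p-1}^i},\qquad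 \beta_i(w)=\sum_{j=0}^\infty b_{i,j}w^j,$$ as an identity of power series in $q$ over $\mathbb C_p$, with coefficientwise convergence. Then $b_{0,0}=1$ and $b_{i,0}=0$ for all $i>0$. -/

import Mathlib

namespace KatzEisenstein

noncomputable section

/-! ### Integral `q`-expansions at level one and Lauder's splitting -/

/-- The `q`-expansion of the normalized Eisenstein series of even weight `k ≥ 4` and level one,
`E_k = 1 - (2k / B_k) ∑_{n ≥ 1} σ_{k-1}(n) q ^ n`. -/
def eisensteinQ (k : ℕ) : PowerSeries ℚ :=
  PowerSeries.mk fun n =>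
    if n = 0 then 1 else -(2 * k / bernoulli k) * (ArithmeticFunction.sigma (k - 1) n : ℚ)

/-- This is the `q`-expansion of Mathlib's normalized Eisenstein series `E_k`. -/
theorem map_eisensteinQ {k : ℕ} (hk : 3 ≤ k) (hk2 : Even k) :
    (eisensteinQ k).map (algebraMap ℚ ℂ) =
      UpperHalfPlane.qExpansion 1 (ModularForm.E hk) := by
  ext n
  rw [EisensteinSeries.E_qExpansion_coeff hk hk2]
  by_cases h : n = 0 <;> simp [eisensteinQ, h]

/-- The `q`-expansion of `E_4`. -/
def E4 : PowerSeries ℤ :=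
  PowerSeries.mk fun n => if n = 0 then 1 else 240 * (ArithmeticFunction.sigma 3 n : ℤ)

/-- The `q`-expansion of `E_6`. -/
def E6 : PowerSeries ℤ :=
  PowerSeries.mk fun n => if n = 0 then 1 else -504 * (ArithmeticFunction.sigma 5 n : ℤ)

theorem map_E4 : E4.map (algebraMap ℤ ℂ) = UpperHalfPlane.qExpansion 1 ModularForm.E₄ := by
  have h1 := ModularForm.E₄_qExpansion_coeff_one
  rw [EisensteinSeries.E_qExpansion_coeff (by norm_num) (by decide)] at h1
  simp only [one_ne_zero, if_false, ArithmeticFunction.sigma_one, Nat.cast_one, mul_one] at h1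
  ext n
  rw [EisensteinSeries.E_qExpansion_coeff (by norm_num) (by decide), h1]
  by_cases h : n = 0 <;> simp [E4, h]

theorem map_E6 : E6.map (algebraMap ℤ ℂ) = UpperHalfPlane.qExpansion 1 ModularForm.E₆ := by
  have h1 := ModularForm.E₆_qExpansion_coeff_one
  rw [EisensteinSeries.E_qExpansion_coeff (by norm_num) (by decide)] at h1
  simp only [one_ne_zero, if_false, ArithmeticFunction.sigma_one, Nat.cast_one, mul_one] at h1
  ext n
  rw [EisensteinSeries.E_qExpansion_coeff (by norm_num) (by decide), h1]
  by_cases h : n = 0 <;> simp [E6, h]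

/-- The `q`-expansion `q ∏_{m ≥ 1} (1 - q ^ m) ^ 24` of the normalized cusp form of weight `12` and
level one. Factors with `m > n` do not change the coefficient of `q ^ n`. -/
def Delta : PowerSeries ℤ :=
  PowerSeries.mk fun n =>
    PowerSeries.coeff n (PowerSeries.X * ∏ m ∈ Finset.Icc 1 n, (1 - PowerSeries.X ^ m) ^ 24)

/-- `dimM n` is the dimension `d_n` of the space of modular forms of even weight `n` and level
one. -/
def dimM (n : ℕ) : ℕ := n / 12 + if n % 12 = 2 then 0 else 1

/-- `ε(k)`, which is `0` if `k ≡ 0 mod 4` and `1` if `k ≡ 2 mod 4`. -/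
def eps (k : ℕ) : ℕ := if k % 4 = 2 then 1 else 0

/-- The form `g_{i,j} = Δ ^ j E_4 ^ a E_6 ^ ε` of weight `i (p - 1)`, where `ε = ε(i (p - 1))` and
`a = (i (p - 1) - 12 j - 6 ε) / 4`. For `p ≥ 5` and `j < d_{i (p - 1)}` the subtractions and the
division in `a` are exact. -/
def g (p i j : ℕ) : PowerSeries ℤ :=
  Delta ^ j * E4 ^ ((i * (p - 1) - 12 * j - 6 * eps (i * (p - 1))) / 4) * E6 ^ eps (i * (p - 1))

variable (p : ℕ) [Fact p.Prime]

/-- The `ℤ_p`-module `B_i(ℤ_p)` of Lauder's splitting: `B_0(ℤ_p) = ℤ_p`, and for `i > 0` it is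
spanned by the `g_{i,j}` with `d_{(i-1)(p-1)} ≤ j ≤ d_{i(p-1)} - 1`. -/
def B (i : ℕ) : Submodule ℤ_[p] (PowerSeries ℤ_[p]) :=
  if i = 0 then Submodule.span ℤ_[p] {1}
  else Submodule.span ℤ_[p] ((fun j => (g p i j).map (algebraMap ℤ ℤ_[p])) ''
    Set.Ico (dimM ((i - 1) * (p - 1))) (dimM (i * (p - 1))))

/-! ### Weights -/

/-- The weight space: continuous characters of `ℤ_p^×` with values in `ℂ_p^×`. -/
abbrev Weight := ℤ_[p]ˣ →ₜ* ℂ_[p]ˣ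

variable {p}

/-- The characters that are trivial on the `(p - 1)`st roots of unity. -/
def IsTrivialOnRoots (κ : Weight p) : Prop := ∀ u : ℤ_[p]ˣ, u ^ (p - 1) = 1 → κ u = 1

/-- The value of a weight at a natural number prime to `p` (and `0` at multiples of `p`). -/
def Weight.eval (κ : Weight p) (d : ℕ) : ℂ_[p] :=
  open Classical in if h : IsUnit (d : ℤ_[p]) then (κ h.unit : ℂ_[p]) else 0

/-- The parameter `w(κ) = κ(p + 1) - 1`. -/
def Weight.w (κ : Weight p) : ℂ_[p] := κ.eval (p + 1) - 1

/-! ### The `p`-adic zeta function -/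

variable (p) in
/-- The regularized first Bernoulli distribution `E_{1,c}` on `ℤ_p`, for `c` prime to `p`:
`E_{1,c}(a + p ^ n ℤ_p) = B_1({a / p ^ n}) - c B_1({c⁻¹ a / p ^ n})` with `B_1(x) = x - 1 / 2`. -/
def bernoulliDist (c n : ℕ) (a : ZMod (p ^ n)) : ℚ :=
  ((a.val : ℚ) / p ^ n - 1 / 2) -
    c * ((((c : ZMod (p ^ n))⁻¹ * a).val : ℚ) / p ^ n - 1 / 2)

/-- The integral `∫ κ(x) x⁻¹ dE_{1,1+p}(x)` over `ℤ_p^×`, as a limit of Riemann sums. -/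
def bernoulliIntegral (κ : Weight p) : ℂ_[p] :=
  Filter.limUnder Filter.atTop fun n : ℕ =>
    ∑ a ∈ (Finset.range (p ^ n)).filter (fun a => ¬ p ∣ a),
      κ.eval a * (a : ℂ_[p])⁻¹ * (bernoulliDist p (p + 1) n (a : ZMod (p ^ n)) : ℂ_[p])

/-- The `p`-adic zeta function
`ζ*(κ) = (κ(c) - 1)⁻¹ ∫ κ(x) x⁻¹ dE_{1,c}(x)`, `c = 1 + p`, for `κ` trivial on the `(p - 1)`st roots
of unity and `κ ≠ 1` (so that `κ(1 + p) ≠ 1`). At `κ(x) = x ^ k`, with `k > 0` divisible by `p - 1`,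
it is `(1 - p ^ (k - 1)) ζ(1 - k)`. -/
def zetaStar (κ : Weight p) : ℂ_[p] := (κ.eval (p + 1) - 1)⁻¹ * bernoulliIntegral κ

/-! ### The Eisenstein family and its formal Katz expansion -/

/-- The `q`-expansion of `E*_κ = 1 + (2 / ζ*(κ)) ∑_{n ≥ 1} (∑_{d ∣ n, p ∤ d} κ(d) d⁻¹) q ^ n`. -/
def eisensteinStar (κ : Weight p) : PowerSeries ℂ_[p] :=
  PowerSeries.mk fun n =>
    if n = 0 then 1
    else 2 / zetaStar κ *
      ∑ d ∈ n.divisors.filter (fun d => ¬ p ∣ d), κ.eval d * (d : ℂ_[p])⁻¹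

/-- The operator `V`, acting on `q`-expansions by `q ↦ q ^ p`. -/
def V (f : PowerSeries ℂ_[p]) : PowerSeries ℂ_[p] :=
  PowerSeries.expand p (Fact.out : p.Prime).ne_zero f

variable (p) in
/-- The `q`-expansion of `E_{p-1}`, with coefficients in `ℂ_p`. -/
def Epm1 : PowerSeries ℂ_[p] := (eisensteinQ (p - 1)).map (algebraMap ℚ ℂ_[p])

/-- `β(w) = ∑_j b_j w ^ j`, a power series in `q` whose coefficients are convergent sums in `ℂ_p`
for `|w| < 1`. -/
def beta (b : ℕ → PowerSeries ℤ_[p]) (w : ℂ_[p]) : PowerSeries ℂ_[p] :=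
  PowerSeries.mk fun n =>
    ∑' j, algebraMap ℚ_[p] ℂ_[p] (PowerSeries.coeff n (b j) : ℤ_[p]) * w ^ j

/-- The `b_{i,j}` are the coefficients of the formal Katz expansion of `E*_κ / V(E*_κ)`:
`b_{i,j} ∈ B_i(ℤ_p)`, and `E*_κ / V(E*_κ) = ∑_i β_i(w(κ)) / E_{p-1} ^ i` for every weight `κ ≠ 1`
that is trivial on the `(p - 1)`st roots of unity, where `β_i(w) = ∑_j b_{i,j} w ^ j`. The sum over
`i` of power series in `q` is taken coefficientwise. -/
structure IsFormalKatzExpansion (b : ℕ → ℕ → PowerSeries ℤ_[p]) : Prop where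
  mem : ∀ i j, b i j ∈ B p i
  hasSum : ∀ κ : Weight p, IsTrivialOnRoots κ → κ ≠ 1 → ∀ n : ℕ,
    HasSum (fun i => PowerSeries.coeff n (beta (b i) κ.w * ((Epm1 p)⁻¹) ^ i))
      (PowerSeries.coeff n (eisensteinStar κ * (V (eisensteinStar κ))⁻¹))

end

end KatzEisenstein

/-! ### Uniqueness of expansions along Lauder's splitting -/

namespace KatzEisenstein

open PowerSeries

/-! The series `b i 0` form the Katz expansion at `w = 0`, the trivial character, where `E*_κ`
degenerates to `1` because `ζ*` has a pole. Approach it along `κ = x ^ k` with `k = (p - 1) p ^ m`.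
The integral in `ζ*(κ)` is a unit, being `≡ -∑ a ^ k ≡ 1` mod `p` over `0 < a < p`, so `|ζ*(κ)| =
|w(κ)|⁻¹` (`norm_zetaStar_powWeight`). Hence `E*_κ ≡ 1` modulo `w(κ)`, and so is `E*_κ / V(E*_κ)`;
since `w(κ) → 0`, the quotient tends to `1` coefficientwise. On the Katz side elements of `B_i`
vanish to order `d_{(i-1)(p-1)}`, so each coefficient of `q` sees finitely many `i` and the limit is
termwise: `∑ b_{i,0} / E_{p-1} ^ i = 1` (`sum_coeff_katz_eq_coeff_one`). Finally `g_{i,j} = q ^ j +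
⋯`, with consecutive ranges of `j` for successive `i`. This triangular shape makes expansions unique
(`eq_zero_of_sum_eq_zero`), and `1` is its own expansion. -/

theorem exists_Delta_eq : ∃ u : PowerSeries ℤ, constantCoeff u = 1 ∧ Delta = X * u := by
  have h : (X : PowerSeries ℤ) ∣ Delta := by
    rw [X_dvd_iff]
    simp [Delta, ← coeff_zero_eq_constantCoeff_apply]
  obtain ⟨u, hu⟩ := h
  refine ⟨u, ?_, hu⟩
  have h1 : coeff 1 Delta = 1 := by
    rw [Delta, coeff_mk, show (1 : ℕ) = 0 + 1 from rfl, coeff_succ_X_mul]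
    simp
  rw [hu, show (1 : ℕ) = 0 + 1 from rfl, coeff_succ_X_mul] at h1
  simpa using h1

/-- Only the constant terms of `E4` and `E6` matter, so truncation in the exponent of `E4` is
harmless and no bound on `j` is needed. -/
theorem exists_g_eq (p i j : ℕ) :
    ∃ v : PowerSeries ℤ, constantCoeff v = 1 ∧ g p i j = X ^ j * v := by
  obtain ⟨u, hu, hD⟩ := exists_Delta_eq
  refine ⟨u ^ j * E4 ^ ((i * (p - 1) - 12 * j - 6 * eps (i * (p - 1))) / 4) *
    E6 ^ eps (i * (p - 1)), ?_, ?_⟩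
  · have h4 : constantCoeff E4 = 1 := by simp [E4, ← coeff_zero_eq_constantCoeff_apply]
    have h6 : constantCoeff E6 = 1 := by simp [E6, ← coeff_zero_eq_constantCoeff_apply]
    simp [hu, h4, h6]
  · rw [g, hD, mul_pow]
    ring

theorem coeff_g_of_lt (p i : ℕ) {n j : ℕ} (h : n < j) : coeff n (g p i j) = 0 := by
  obtain ⟨v, -, hv⟩ := exists_g_eq p i j
  rw [hv, coeff_X_pow_mul', if_neg (by omega)]

theorem coeff_g_self (p i j : ℕ) : coeff j (g p i j) = 1 := by
  obtain ⟨v, hv1, hv⟩ := exists_g_eq p i j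
  rw [hv, coeff_X_pow_mul', if_pos le_rfl]
  simpa using hv1

/-- Elements of a triangular span of power series are determined by finitely many coefficients. -/
theorem eq_zero_of_mem_span_of_coeff {R : Type*} [CommRing R] {f : ℕ → PowerSeries R}
    (h0 : ∀ j n, n < j → coeff n (f j) = 0) (h1 : ∀ j, coeff j (f j) = 1) (u : ℕ) :
    ∀ k l : ℕ, u ≤ l + k → ∀ c ∈ Submodule.span R (f '' Set.Ico l u),
      (∀ n < u, coeff n c = 0) → c = 0
  | 0, l, h, c, hc, _ => by
    rw [Set.Ico_eq_empty (by omega)] at hc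
    simpa using hc
  | k + 1, l, h, c, hc, hz => by
    by_cases hlu : u ≤ l
    · exact eq_zero_of_mem_span_of_coeff h0 h1 u 0 l (by omega) c hc hz
    -- Among the remaining generators only `f l` has a nonzero coefficient at `l`, so its multiplier
    -- vanishes. The recursion runs on `k`, a bound for `u - l`.
    have hI : Set.Ico l u = insert l (Set.Ico (l + 1) u) := by
      ext x; simp only [Set.mem_Ico, Set.mem_insert_iff]; omega
    rw [hI, Set.image_insert_eq, Submodule.mem_span_insert] at hc
    obtain ⟨a, z, hzs, rfl⟩ := hc
    have hzl : coeff l z = 0 := by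
      refine Submodule.span_induction (p := fun y _ => coeff l y = 0) ?_ (by simp) ?_ ?_ hzs
      · rintro _ ⟨j, hj, rfl⟩
        exact h0 j l (Set.mem_Ico.1 hj).1
      · intro x y _ _ hx hy; simp [hx, hy]
      · intro r x _ hx; simp [hx]
    have ha : a = 0 := by simpa [hzl, h1] using hz l (by omega)
    subst ha
    simp only [zero_smul, zero_add] at hz ⊢
    exact eq_zero_of_mem_span_of_coeff h0 h1 u k (l + 1) (by omega) z hzs hz

/-- `dimM` is not monotone: it drops from `2` at `12` to `1` at `14`. A gap of `4` avoids this, and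
distinct multiples of `p - 1 ≥ 4` have it. -/
theorem dimM_mono {m n : ℕ} (hmn : m = n ∨ m + 4 ≤ n) : dimM m ≤ dimM n := by
  unfold dimM; split_ifs <;> omega

theorem le_dimM (n : ℕ) : n / 12 ≤ dimM n := by
  unfold dimM; omega

variable {p : ℕ} [Fact p.Prime]

theorem coeff_eq_zero_of_mem_B {i n : ℕ} (hi : 0 < i) (hn : n < dimM ((i - 1) * (p - 1)))
    {c : PowerSeries ℤ_[p]} (hc : c ∈ B p i) : coeff n c = 0 := by
  rw [B, if_neg hi.ne'] at hc
  refine Submodule.span_induction (p := fun y _ => coeff n y = 0) ?_ (by simp) ?_ ?_ hc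
  · rintro _ ⟨j, hj, rfl⟩
    simp [coeff_g_of_lt p i (hn.trans_le (Set.mem_Ico.1 hj).1)]
  · intro x y _ _ hx hy; simp [hx, hy]
  · intro r x _ hx; simp [hx]

theorem eq_zero_of_mem_B {i : ℕ} {c : PowerSeries ℤ_[p]} (hc : c ∈ B p i)
    (h : ∀ n < dimM (i * (p - 1)), coeff n c = 0) : c = 0 := by
  by_cases hi : i = 0
  · subst hi
    rw [B, if_pos rfl, Submodule.mem_span_singleton] at hc
    obtain ⟨a, rfl⟩ := hc
    have := h 0 (by simp [dimM])
    simp only [coeff_smul, coeff_one, if_true] at this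
    have ha : a = 0 := by simpa using this
    simp [ha]
  · rw [B, if_neg hi] at hc
    refine eq_zero_of_mem_span_of_coeff (f := fun j => (g p i j).map (algebraMap ℤ ℤ_[p]))
      ?_ ?_ (dimM (i * (p - 1))) (dimM (i * (p - 1))) _ (by omega) c hc h
    · intro j n hnj; simp [coeff_g_of_lt p i hnj]
    · intro j; simp [coeff_g_self]

theorem dimM_mul_mono (hp : 5 ≤ p) {i j : ℕ} (hij : i ≤ j) :
    dimM (i * (p - 1)) ≤ dimM (j * (p - 1)) := by
  apply dimM_mono
  rcases hij.eq_or_lt with rfl | h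
  · exact Or.inl rfl
  · right
    obtain ⟨k, rfl⟩ := Nat.exists_eq_add_of_lt h
    obtain ⟨q, rfl⟩ := Nat.exists_eq_add_of_le hp
    have : (i + k + 1) * (5 + q - 1) = i * (5 + q - 1) + (k + 1) * (5 + q - 1) := by ring
    rw [this]
    have : 1 * 4 ≤ (k + 1) * (5 + q - 1) := Nat.mul_le_mul (by omega) (by omega)
    omega

omit [Fact p.Prime] in
-- A crude explicit bound on the indices `i` that can contribute to the coefficient of `q ^ n`.
theorem lt_dimM_of_le (hp : 5 ≤ p) {i n : ℕ} (h : 12 * n + 13 ≤ i) :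
    n < dimM ((i - 1) * (p - 1)) := by
  refine lt_of_lt_of_le ?_ (le_dimM _)
  have : (12 * n + 12) * 1 ≤ (i - 1) * (p - 1) := Nat.mul_le_mul (by omega) (by omega)
  omega

/-- Uniqueness of the Katz expansion with respect to Lauder's splitting. -/
theorem eq_zero_of_sum_eq_zero (hp : 5 ≤ p) {K : Type*} [Field K] (φ : ℤ_[p] →+* K)
    (hφ : Function.Injective φ) {F : PowerSeries K} (hF : constantCoeff F = 1)
    {c : ℕ → PowerSeries ℤ_[p]} (hc : ∀ i, c i ∈ B p i)
    (hsum : ∀ n, ∑ i ∈ Finset.range (12 * n + 13), coeff n ((c i).map φ * F ^ i) = 0) (i : ℕ) :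
    c i = 0 := by
  induction i using Nat.strong_induction_on with
  | _ i ih =>
    apply eq_zero_of_mem_B (hc i)
    -- As `F ^ i` has constant term `1`, vanishing of initial coefficients passes from the product
    -- to `c i`, by induction on the degree.
    suffices h : ∀ n < dimM (i * (p - 1)), coeff n ((c i).map φ * F ^ i) = 0 by
      intro n hn
      induction n using Nat.strong_induction_on with
      | _ n ihn =>
        have h1 := h n hn
        rw [coeff_mul, Finset.sum_eq_single (n, 0)] at h1
        · apply hφ
          simpa [hF] using h1
        · rintro ⟨x, y⟩ hxy hne
          rw [Finset.HasAntidiagonal.mem_antidiagonal] at hxy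
          have hx : x < n := by
            rcases Nat.lt_or_ge x n with h | h
            · exact h
            · exfalso; apply hne; ext <;> simp at * <;> omega
          simp [ihn x hx (hx.trans hn)]
        · simp
    intro n hn
    -- For `k > i` the order of vanishing is at least `d_{(k-1)(p-1)} ≥ d_{i(p-1)} > n`; smaller `k`
    -- are killed by induction.
    have hlow : ∀ k, i < k → coeff n ((c k).map φ * F ^ k) = 0 := by
      intro k hk
      rw [coeff_mul]
      refine Finset.sum_eq_zero fun x hx => ?_
      rw [Finset.HasAntidiagonal.mem_antidiagonal] at hx
      have : x.1 < dimM ((k - 1) * (p - 1)) :=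
        lt_of_le_of_lt (by omega) (hn.trans_le (dimM_mul_mono hp (by omega)))
      simp [coeff_eq_zero_of_mem_B (by omega) this (hc k)]
    by_cases hi : i < 12 * n + 13
    · rw [← hsum n, Finset.sum_eq_single i]
      · intro k _ hk
        rcases Nat.lt_or_gt_of_ne hk with h | h
        · simp [ih k h]
        · exact hlow k h
      · intro h; exact absurd (Finset.mem_range.2 hi) h
    · rw [coeff_mul]
      refine Finset.sum_eq_zero fun x hx => ?_
      rw [Finset.HasAntidiagonal.mem_antidiagonal] at hx
      have : x.1 < dimM ((i - 1) * (p - 1)) :=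
        lt_of_le_of_lt (by omega) (lt_dimM_of_le hp (not_lt.1 hi))
      simp [coeff_eq_zero_of_mem_B (by omega) this (hc i)]

end KatzEisenstein

namespace KatzEisenstein

/-! ### Rational and integral points of `ℂ_p` -/

section Norm

variable {p : ℕ} [Fact p.Prime]

theorem norm_natCast_complex (n : ℕ) : ‖(n : ℂ_[p])‖ = ‖(n : ℚ_[p])‖ := by
  rw [← map_natCast (algebraMap ℚ_[p] ℂ_[p]), norm_algebraMap']

theorem norm_intCast_complex_le_one (z : ℤ) : ‖(z : ℂ_[p])‖ ≤ 1 := by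
  rw [← map_intCast (algebraMap ℚ_[p] ℂ_[p]), norm_algebraMap']
  exact Padic.norm_int_le_one z

theorem norm_natCast_complex_le_one (n : ℕ) : ‖(n : ℂ_[p])‖ ≤ 1 := by
  exact_mod_cast norm_intCast_complex_le_one (p := p) (n : ℤ)

theorem norm_intCast_complex_le_of_dvd {z : ℤ} {n : ℕ} (h : (p : ℤ) ^ n ∣ z) :
    ‖(z : ℂ_[p])‖ ≤ (p : ℝ)⁻¹ ^ n := by
  obtain ⟨y, rfl⟩ := h
  push_cast
  rw [norm_mul, norm_pow, norm_natCast_complex, Padic.norm_p]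
  exact mul_le_of_le_one_right (by positivity) (norm_intCast_complex_le_one y)

theorem norm_two_complex (hp : 5 ≤ p) : ‖(2 : ℂ_[p])‖ = 1 := by
  have := norm_natCast_complex (p := p) 2
  rw [Padic.norm_natCast_eq_one_iff.2] at this
  · exact_mod_cast this
  · rw [Nat.coprime_comm, Nat.coprime_primes Nat.prime_two Fact.out]
    omega

theorem norm_sub_le_max_complex (x y : ℂ_[p]) : ‖x - y‖ ≤ max ‖x‖ ‖y‖ := by
  simpa [sub_eq_add_neg] using IsUltrametricDist.norm_add_le_max x (-y)

end Norm

/-! ### The Bernoulli distribution -/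

section Bernoulli

/-- The multiplication formula `∑_{t < p} B_1((y + t) / p) = B_1(y)` at `y = x / p ^ n`: the fibre
consists of the classes of `x + p ^ n t`. -/
theorem sum_val_div_fiber {p : ℕ} [NeZero p] (n : ℕ) (x : ZMod (p ^ n)) :
    ∑ y : ZMod (p ^ (n + 1)) with ZMod.castHom (pow_dvd_pow p n.le_succ) (ZMod (p ^ n)) y = x,
      ((y.val : ℚ) / p ^ (n + 1) - 1 / 2) = (x.val : ℚ) / p ^ n - 1 / 2 := by
  have hp : p ≠ 0 := NeZero.ne p
  have hp' : (p : ℚ) ≠ 0 := by exact_mod_cast hp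
  have hval : ∀ t < p, ((x.val + p ^ n * t : ℕ) : ZMod (p ^ (n + 1))).val = x.val + p ^ n * t := by
    intro t ht
    rw [ZMod.val_natCast, Nat.mod_eq_of_lt]
    have h1 := ZMod.val_lt x
    calc x.val + p ^ n * t < p ^ n + p ^ n * t := by omega
      _ = p ^ n * (t + 1) := by ring
      _ ≤ p ^ n * p := Nat.mul_le_mul le_rfl ht
      _ = p ^ (n + 1) := by ring
  have hfib : ∀ y : ZMod (p ^ (n + 1)),
      ZMod.castHom (pow_dvd_pow p n.le_succ) (ZMod (p ^ n)) y = x ↔ y.val % p ^ n = x.val := by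
    intro y
    rw [← (ZMod.val_injective _).eq_iff, ZMod.castHom_apply, ZMod.cast_eq_val, ZMod.val_natCast]
  have hpn : 0 < p ^ n := Nat.pow_pos (Nat.pos_of_ne_zero hp)
  calc _ = ∑ t ∈ Finset.range p, (((x.val + p ^ n * t : ℕ) : ℚ) / p ^ (n + 1) - 1 / 2) := by
        refine Finset.sum_bij' (fun y _ => y.val / p ^ n)
          (fun t _ => ((x.val + p ^ n * t : ℕ) : ZMod (p ^ (n + 1)))) ?_ ?_ ?_ ?_ ?_
        · intro y _
          rw [Finset.mem_range, Nat.div_lt_iff_lt_mul hpn]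
          have := ZMod.val_lt y
          exact this.trans_eq (pow_succ' p n)
        · intro t ht
          rw [Finset.mem_range] at ht
          simp only [Finset.mem_filter, Finset.mem_univ, true_and]
          rw [hfib, hval t ht, Nat.add_mul_mod_self_left, Nat.mod_eq_of_lt (ZMod.val_lt x)]
        · intro y hy
          simp only [Finset.mem_filter, Finset.mem_univ, true_and] at hy
          rw [hfib] at hy
          rw [← hy, Nat.mod_add_div, ZMod.natCast_zmod_val]
        · intro t ht
          rw [Finset.mem_range] at ht
          rw [hval t ht, Nat.add_mul_div_left _ _ hpn, Nat.div_eq_of_lt (ZMod.val_lt x), zero_add]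
        · intro y hy
          simp only [Finset.mem_filter, Finset.mem_univ, true_and] at hy
          rw [hfib] at hy
          rw [← hy, Nat.mod_add_div]
    _ = _ := by
        rw [Finset.sum_sub_distrib, ← Finset.sum_div]
        push_cast
        rw [Finset.sum_add_distrib, ← Finset.mul_sum, ← Nat.cast_sum (Finset.range p) fun t => t]
        have h2 : ((∑ t ∈ Finset.range p, t : ℕ) : ℚ) * 2 = p * (p - 1) := by
          have := Finset.sum_range_id_mul_two p
          have h3 : ((p - 1 : ℕ) : ℚ) = p - 1 := by
            rw [Nat.cast_sub (by omega)]; simp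
          rw [← h3]; exact_mod_cast this
        have h4 : ((∑ t ∈ Finset.range p, t : ℕ) : ℚ) = p * (p - 1) / 2 := by linarith
        rw [h4]
        simp only [Finset.sum_const, Finset.card_range, nsmul_eq_mul]
        field_simp
        ring

theorem castHom_inv_natCast {m n : ℕ} (h : m ∣ n) {c : ℕ} (hc : c.Coprime n) :
    ZMod.castHom h (ZMod m) ((c : ZMod n)⁻¹) = (c : ZMod m)⁻¹ := by
  have h1 := congrArg (ZMod.castHom h (ZMod m)) (ZMod.coe_mul_inv_eq_one c hc)
  rw [map_mul, map_natCast, map_one] at h1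
  have h2 := ZMod.coe_mul_inv_eq_one c (hc.coprime_dvd_right h)
  calc _ = (c : ZMod m)⁻¹ * c * ZMod.castHom h (ZMod m) ((c : ZMod n)⁻¹) := by
        rw [mul_comm _ (c : ZMod m), h2, one_mul]
    _ = _ := by rw [mul_assoc, h1, mul_one]

theorem coprime_succ_pow (p n : ℕ) : (p + 1).Coprime (p ^ n) := by
  apply Nat.Coprime.pow_right
  simp

/-- The distribution relation for `E_{1,c}`. -/
theorem sum_bernoulliDist_fiber {p : ℕ} [NeZero p] {c : ℕ} (n : ℕ)
    (hc : c.Coprime (p ^ (n + 1))) (x : ZMod (p ^ n)) :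
    ∑ y : ZMod (p ^ (n + 1)) with ZMod.castHom (pow_dvd_pow p n.le_succ) (ZMod (p ^ n)) y = x,
      bernoulliDist p c (n + 1) y = bernoulliDist p c n x := by
  have hdvd := pow_dvd_pow p n.le_succ
  have h1 := ZMod.coe_mul_inv_eq_one c hc
  have h2 := ZMod.coe_mul_inv_eq_one c (hc.coprime_dvd_right hdvd)
  have h3 := castHom_inv_natCast hdvd hc
  unfold bernoulliDist
  rw [Finset.sum_sub_distrib, ← Finset.mul_sum, sum_val_div_fiber,
    ← sum_val_div_fiber n ((c : ZMod (p ^ n))⁻¹ * x)]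
  congr 2
  -- Multiplication by `c⁻¹` carries the fibre over `x` bijectively onto the fibre over `c⁻¹ x`.
  refine Finset.sum_bij' (fun y _ => (c : ZMod (p ^ (n + 1)))⁻¹ * y)
    (fun y _ => (c : ZMod (p ^ (n + 1))) * y) ?_ ?_ ?_ ?_ ?_
  · intro y hy
    simp only [Finset.mem_filter, Finset.mem_univ, true_and] at hy ⊢
    rw [map_mul, h3, hy]
  · intro y hy
    simp only [Finset.mem_filter, Finset.mem_univ, true_and] at hy ⊢
    rw [map_mul, hy, map_natCast, ← mul_assoc, h2, one_mul]
  · intro y _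
    rw [← mul_assoc, h1, one_mul]
  · intro y _
    rw [← mul_assoc, mul_comm _ (c : ZMod (p ^ (n + 1))), h1, one_mul]
  · intro y _
    rfl

/-- `E_{1,c}` takes values in `ℤ + (c - 1) / 2`. -/
theorem exists_bernoulliDist_eq {p : ℕ} [NeZero p] {c n : ℕ} (hc : c.Coprime (p ^ n))
    (x : ZMod (p ^ n)) : ∃ z : ℤ, bernoulliDist p c n x = z + ((c : ℚ) - 1) / 2 := by
  set r := ((c : ZMod (p ^ n))⁻¹ * x).val with hr
  have h : ((p ^ n : ℕ) : ℤ) ∣ (x.val : ℤ) - c * r := by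
    rw [← ZMod.intCast_zmod_eq_zero_iff_dvd]
    push_cast
    rw [hr, ZMod.natCast_zmod_val, ZMod.natCast_zmod_val, ← mul_assoc,
      ZMod.coe_mul_inv_eq_one c hc, one_mul, sub_self]
  obtain ⟨z, hz⟩ := h
  refine ⟨z, ?_⟩
  have hz' : (x.val : ℚ) - c * r = p ^ n * z := by exact_mod_cast hz
  have hp' : (p : ℚ) ^ n ≠ 0 := pow_ne_zero _ (Nat.cast_ne_zero.2 (NeZero.ne p))
  have hz2 : (z : ℚ) = (x.val - c * r) / p ^ n := by
    rw [hz', mul_div_cancel_left₀ _ hp']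
  rw [bernoulliDist, ← hr, hz2]
  ring

end Bernoulli

/-! ### The integral of `x ^ (k - 1)` -/

section Integral

variable {p : ℕ} [Fact p.Prime]

/-- For `c = p + 1` the non-integral part is `p / 2`, which is `p`-integral as `p` is odd. So the
distribution is a bounded measure. -/
theorem norm_bernoulliDist_le_one (hp : 5 ≤ p) (n : ℕ) (x : ZMod (p ^ n)) :
    ‖(bernoulliDist p (p + 1) n x : ℂ_[p])‖ ≤ 1 := by
  obtain ⟨z, hz⟩ := exists_bernoulliDist_eq (coprime_succ_pow p n) x
  rw [hz]
  push_cast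
  refine (IsUltrametricDist.norm_add_le_max _ _).trans (max_le (norm_intCast_complex_le_one z) ?_)
  rw [add_sub_cancel_right, norm_div, norm_two_complex hp, div_one]
  exact norm_natCast_complex_le_one p

/-- The function `x ^ m` on `ℤ_p^×`, extended by `0`. -/
def unitPow (p m a : ℕ) : ℤ := if p ∣ a then 0 else (a : ℤ) ^ m

theorem pow_dvd_unitPow_sub (p m a n : ℕ) (hn : n ≠ 0) :
    (p : ℤ) ^ n ∣ unitPow p m a - unitPow p m (a % p ^ n) := by
  have h : p ∣ a % p ^ n ↔ p ∣ a := Nat.dvd_mod_iff (dvd_pow_self p hn)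
  unfold unitPow
  simp only [h]
  split_ifs
  · simp
  · refine dvd_trans ?_ (sub_dvd_pow_sub_pow _ _ m)
    push_cast
    exact Int.dvd_self_sub_emod

/-- The Riemann sums of `x ^ m` over `ℤ_p^×` with respect to `E_{1,1+p}`. -/
noncomputable def riemannSum (p : ℕ) [Fact p.Prime] (m n : ℕ) : ℂ_[p] :=
  ∑ a ∈ Finset.range (p ^ n),
    (unitPow p m a : ℂ_[p]) * (bernoulliDist p (p + 1) n (a : ZMod (p ^ n)) : ℂ_[p])

theorem riemannSum_eq_sum_zmod (m n : ℕ) :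
    riemannSum p m n = ∑ x : ZMod (p ^ n),
      (unitPow p m x.val : ℂ_[p]) * (bernoulliDist p (p + 1) n x : ℂ_[p]) := by
  refine Finset.sum_bij' (fun a _ => (a : ZMod (p ^ n))) (fun x _ => x.val) ?_ ?_ ?_ ?_ ?_
  · simp
  · intro x _; exact Finset.mem_range.2 (ZMod.val_lt x)
  · intro a ha
    exact ZMod.val_cast_of_lt (Finset.mem_range.1 ha)
  · intro x _; exact ZMod.natCast_zmod_val x
  · intro a ha
    rw [ZMod.val_cast_of_lt (Finset.mem_range.1 ha)]

/-- By the distribution relation, level `n` is a level `n + 1` sum with the integrand read at `y mod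
p ^ n`. This changes the integrand by a multiple of `p ^ n`, against a bounded measure. -/
theorem norm_riemannSum_succ_sub_le (hp : 5 ≤ p) (m : ℕ) {n : ℕ} (hn : n ≠ 0) :
    ‖riemannSum p m (n + 1) - riemannSum p m n‖ ≤ (p : ℝ)⁻¹ ^ n := by
  have h : riemannSum p m n = ∑ y : ZMod (p ^ (n + 1)),
      (unitPow p m (y.val % p ^ n) : ℂ_[p]) * (bernoulliDist p (p + 1) (n + 1) y : ℂ_[p]) := by
    rw [riemannSum_eq_sum_zmod,
      ← Finset.sum_fiberwise _ (ZMod.castHom (pow_dvd_pow p n.le_succ) (ZMod (p ^ n)))]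
    refine Finset.sum_congr rfl fun x _ => ?_
    rw [← sum_bernoulliDist_fiber n (coprime_succ_pow p (n + 1)) x, Rat.cast_sum,
      Finset.mul_sum]
    refine Finset.sum_congr rfl fun y hy => ?_
    simp only [Finset.mem_filter, Finset.mem_univ, true_and] at hy
    rw [← hy, ZMod.castHom_apply, ZMod.cast_eq_val, ZMod.val_natCast]
  rw [h, riemannSum_eq_sum_zmod, ← Finset.sum_sub_distrib]
  refine IsUltrametricDist.norm_sum_le_of_forall_le_of_nonneg (by positivity) fun y _ => ?_
  rw [← sub_mul, norm_mul, ← Int.cast_sub]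
  refine (mul_le_of_le_one_right (norm_nonneg _) (norm_bernoulliDist_le_one hp _ _)).trans ?_
  exact norm_intCast_complex_le_of_dvd (pow_dvd_unitPow_sub p m y.val n hn)

/-- At level one `c ≡ 1`, so the measure of the class of `a` is `-a + p / 2`. By Fermat each unit
class contributes `-a ^ k ≡ -1` mod `p`, and `-(p - 1) ≡ 1`. -/
theorem norm_riemannSum_one_sub_one_le (hp : 5 ≤ p) {k : ℕ} (hk : 0 < k) (hpk : p - 1 ∣ k) :
    ‖riemannSum p (k - 1) 1 - 1‖ ≤ (p : ℝ)⁻¹ := by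
  have hp' : (p : ℚ) ≠ 0 := by positivity
  have hE : ∀ a ∈ Finset.range (p ^ 1),
      (bernoulliDist p (p + 1) 1 (a : ZMod (p ^ 1)) : ℂ_[p]) = -a + p / 2 := by
    intro a ha
    have hc : ((p + 1 : ℕ) : ZMod (p ^ 1))⁻¹ = 1 := by
      have : ((p : ℕ) : ZMod (p ^ 1)) = 0 := by
        rw [ZMod.natCast_eq_zero_iff]; simp
      push_cast
      rw [this, zero_add]
      exact ZMod.inv_one _
    have : bernoulliDist p (p + 1) 1 (a : ZMod (p ^ 1)) = -a + p / 2 := by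
      rw [bernoulliDist, hc, one_mul, ZMod.val_cast_of_lt (Finset.mem_range.1 ha)]
      push_cast
      field_simp
      ring
    rw [this]
    push_cast
    rfl
  -- Writing `1 = -(p - 1) + p` allows a termwise comparison.
  have h1 : (1 : ℂ_[p]) = ∑ a ∈ Finset.range (p ^ 1), ((if p ∣ a then 0 else -1 : ℤ) : ℂ_[p]) +
      p := by
    rw [pow_one, Finset.range_eq_Ico, Finset.sum_eq_sum_Ico_succ_bot (by omega),
      Finset.sum_congr rfl (g := fun _ => (-1 : ℂ_[p]))]
    · simp only [dvd_zero, if_true, Finset.sum_const, Nat.card_Ico, nsmul_eq_mul]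
      rw [Nat.cast_sub (by omega)]
      push_cast
      ring
    · intro a ha
      rw [Finset.mem_Ico] at ha
      rw [if_neg (Nat.not_dvd_of_pos_of_lt (by omega) ha.2)]
      simp
  have hpn : ‖(p : ℂ_[p])‖ = (p : ℝ)⁻¹ := by rw [norm_natCast_complex, Padic.norm_p]
  rw [h1, riemannSum, ← sub_sub, ← Finset.sum_sub_distrib]
  refine (norm_sub_le_max_complex _ _).trans (max_le ?_ hpn.le)
  refine IsUltrametricDist.norm_sum_le_of_forall_le_of_nonneg (by positivity) fun a ha => ?_
  rw [hE a ha]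
  unfold unitPow
  split_ifs with hpa
  · simp
  · have hdvd : (p : ℤ) ^ 1 ∣ 1 - (a : ℤ) ^ k := by
      rw [pow_one, ← ZMod.intCast_zmod_eq_zero_iff_dvd]
      push_cast
      obtain ⟨m, rfl⟩ := hpk
      rw [pow_mul, ZMod.pow_card_sub_one_eq_one, one_pow, sub_self]
      rwa [Ne, ZMod.natCast_eq_zero_iff]
    have heq : (((a : ℤ) ^ (k - 1) : ℤ) : ℂ_[p]) * (-a + p / 2) - ((-1 : ℤ) : ℂ_[p]) =
        ((1 - (a : ℤ) ^ k : ℤ) : ℂ_[p]) + p * (((a ^ (k - 1) : ℕ) : ℂ_[p]) / 2) := by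
      obtain ⟨l, rfl⟩ := Nat.exists_eq_succ_of_ne_zero hk.ne'
      push_cast
      simp only [Nat.succ_eq_add_one]
      ring
    rw [heq]
    refine (IsUltrametricDist.norm_add_le_max _ _).trans (max_le ?_ ?_)
    · simpa using norm_intCast_complex_le_of_dvd hdvd
    · rw [norm_mul, hpn, norm_div, norm_two_complex hp, div_one]
      exact mul_le_of_le_one_right (by positivity) (norm_natCast_complex_le_one _)

/-- From level one on, successive sums differ by at most `p⁻¹`, so all of them and their limit stay
congruent to `1` mod `p`. -/
theorem exists_tendsto_riemannSum (hp : 5 ≤ p) {k : ℕ} (hk : 0 < k) (hpk : p - 1 ∣ k) :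
    ∃ I : ℂ_[p], ‖I‖ = 1 ∧ Filter.Tendsto (riemannSum p (k - 1)) Filter.atTop (nhds I) := by
  have hlt : (p : ℝ)⁻¹ < 1 := inv_lt_one_of_one_lt₀ (by exact_mod_cast (by omega : 1 < p))
  have hC : CauchySeq fun n => riemannSum p (k - 1) (n + 1) := by
    refine cauchySeq_of_le_geometric _ 1 hlt fun n => ?_
    rw [dist_comm, dist_eq_norm, one_mul]
    refine (norm_riemannSum_succ_sub_le hp (k - 1) n.succ_ne_zero).trans ?_
    exact pow_le_pow_of_le_one (by positivity) hlt.le n.le_succ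
  obtain ⟨I, hI⟩ := cauchySeq_tendsto_of_complete hC
  have hb : ∀ n, ‖riemannSum p (k - 1) (n + 1) - 1‖ ≤ (p : ℝ)⁻¹ := by
    intro n
    induction n with
    | zero => exact norm_riemannSum_one_sub_one_le hp hk hpk
    | succ n ih =>
      rw [← sub_add_sub_cancel _ (riemannSum p (k - 1) (n + 1)) 1]
      refine (IsUltrametricDist.norm_add_le_max _ _).trans (max_le ?_ ih)
      refine (norm_riemannSum_succ_sub_le hp (k - 1) n.succ_ne_zero).trans ?_
      exact pow_le_of_le_one (by positivity) hlt.le n.succ_ne_zero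
  refine ⟨I, ?_, (Filter.tendsto_add_atTop_iff_nat 1).1 hI⟩
  have hI1 : ‖I - 1‖ ≤ (p : ℝ)⁻¹ :=
    le_of_tendsto (hI.sub_const 1).norm (Filter.Eventually.of_forall hb)
  have hle : ‖I‖ ≤ 1 := by
    rw [← sub_add_cancel I 1]
    exact (IsUltrametricDist.norm_add_le_max _ _).trans (max_le (hI1.trans hlt.le) (by simp))
  refine hle.antisymm ?_
  by_contra! hI0
  have h1 : ‖(1 : ℂ_[p])‖ < 1 := by
    rw [← sub_sub_cancel I 1]
    exact (norm_sub_le_max_complex _ _).trans_lt (max_lt hI0 (hI1.trans_lt hlt))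
  simp at h1

end Integral

/-! ### The weights `x ^ k` -/

section PowWeight

variable {p : ℕ} [Fact p.Prime]

variable (p) in
/-- The weight `x ↦ x ^ k`. -/
noncomputable def powWeight (k : ℕ) : Weight p where
  toMonoidHom := (powMonoidHom k).comp
    (Units.map (((algebraMap ℚ_[p] ℂ_[p]).comp PadicInt.Coe.ringHom : ℤ_[p] →+* ℂ_[p]) :
      ℤ_[p] →* ℂ_[p]))
  continuous_toFun := by
    refine (continuous_pow k).comp (Continuous.units_map _ ?_)
    exact (continuous_algebraMap ℚ_[p] ℂ_[p]).comp continuous_subtype_val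

theorem isUnit_natCast_padicInt {d : ℕ} : IsUnit (d : ℤ_[p]) ↔ ¬ p ∣ d := by
  rw [PadicInt.isUnit_iff, PadicInt.norm_natCast_eq_one_iff,
    Nat.Prime.coprime_iff_not_dvd Fact.out]

theorem coe_powWeight (k : ℕ) (u : ℤ_[p]ˣ) :
    (powWeight p k u : ℂ_[p]) = algebraMap ℚ_[p] ℂ_[p] ((u : ℤ_[p]) : ℚ_[p]) ^ k := rfl

theorem eval_powWeight (k : ℕ) {d : ℕ} (hd : ¬ p ∣ d) :
    (powWeight p k).eval d = (d : ℂ_[p]) ^ k := by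
  rw [Weight.eval, dif_pos (isUnit_natCast_padicInt.2 hd), coe_powWeight]
  simp

theorem w_powWeight (k : ℕ) : (powWeight p k).w = ((p + 1 : ℕ) : ℂ_[p]) ^ k - 1 := by
  rw [Weight.w, eval_powWeight]
  intro h
  have h1 := (Nat.dvd_add_right (dvd_refl p)).1 h
  exact (Fact.out : p.Prime).one_lt.ne' (Nat.dvd_one.1 h1)

theorem eval_powWeight_mul_inv {k : ℕ} (hk : 0 < k) {d : ℕ} (hd : ¬ p ∣ d) :
    (powWeight p k).eval d * (d : ℂ_[p])⁻¹ = (d : ℂ_[p]) ^ (k - 1) := by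
  have hd0 : (d : ℂ_[p]) ≠ 0 := by
    rw [Nat.cast_ne_zero]; rintro rfl; exact hd (dvd_zero p)
  obtain ⟨l, rfl⟩ := Nat.exists_eq_succ_of_ne_zero hk.ne'
  rw [eval_powWeight _ hd, Nat.succ_eq_add_one, Nat.add_sub_cancel, pow_succ,
    mul_inv_cancel_right₀ hd0]

theorem isTrivialOnRoots_powWeight {k : ℕ} (hpk : p - 1 ∣ k) :
    IsTrivialOnRoots (powWeight p k) := by
  intro u hu
  obtain ⟨m, rfl⟩ := hpk
  have h : powWeight p ((p - 1) * m) u = powWeight p m (u ^ (p - 1)) := by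
    ext
    simp [coe_powWeight, ← pow_mul, mul_comm]
  rw [h, hu, map_one]

theorem w_powWeight_ne_zero {k : ℕ} (hk : 0 < k) : (powWeight p k).w ≠ 0 := by
  rw [w_powWeight, sub_ne_zero, ← Nat.cast_pow, Ne, Nat.cast_eq_one]
  exact (Nat.one_lt_pow hk.ne' (by have := (Fact.out : p.Prime).pos; omega)).ne'

theorem powWeight_ne_one {k : ℕ} (hk : 0 < k) : powWeight p k ≠ 1 := by
  intro h
  refine w_powWeight_ne_zero (p := p) hk ?_
  rw [Weight.w, h, Weight.eval, dif_pos]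
  · simp
  · apply isUnit_natCast_padicInt.2
    rw [Nat.dvd_add_right (dvd_refl p), Nat.dvd_one]
    exact (Fact.out : p.Prime).one_lt.ne'

/-- Since `(1 + p) ^ (p ^ m) ≡ 1` mod `p ^ m`, these weights approach the trivial character; the
factor `p - 1` keeps them trivial on the roots of unity. -/
theorem norm_w_powWeight_le (m : ℕ) :
    ‖(powWeight p ((p - 1) * p ^ m)).w‖ ≤ (p : ℝ)⁻¹ ^ m := by
  have h : (p : ℤ) ^ m ∣ ((p + 1 : ℕ) : ℤ) ^ ((p - 1) * p ^ m) - 1 := by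
    have h1 := dvd_sub_pow_of_dvd_sub (R := ℤ) (p := p) (a := p + 1) (b := 1) (by simp) m
    rw [one_pow] at h1
    have h2 := sub_dvd_pow_sub_pow (((p : ℤ) + 1) ^ p ^ m) 1 (p - 1)
    rw [one_pow, ← pow_mul, mul_comm (p ^ m)] at h2
    push_cast
    exact (pow_dvd_pow _ m.le_succ).trans (h1.trans h2)
  simpa [w_powWeight] using norm_intCast_complex_le_of_dvd h

/-- The `p`-adic zeta function has a simple pole at the trivial character. -/
theorem norm_zetaStar_powWeight (hp : 5 ≤ p) {k : ℕ} (hk : 0 < k) (hpk : p - 1 ∣ k) :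
    ‖zetaStar (powWeight p k)‖ = ‖(powWeight p k).w‖⁻¹ := by
  obtain ⟨I, hI1, hI⟩ := exists_tendsto_riemannSum hp hk hpk
  have h : bernoulliIntegral (powWeight p k) = I := by
    refine Filter.Tendsto.limUnder_eq (hI.congr fun n => ?_)
    rw [riemannSum, Finset.sum_filter]
    refine Finset.sum_congr rfl fun a _ => ?_
    by_cases ha : p ∣ a
    · simp [unitPow, ha]
    · rw [if_pos ha, eval_powWeight_mul_inv hk ha, unitPow, if_neg ha]
      push_cast
      rfl
  rw [zetaStar, h, norm_mul, hI1, mul_one, norm_inv, Weight.w]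

end PowWeight

end KatzEisenstein

/-! ### Specialization of the Katz expansion at the trivial character -/

namespace KatzEisenstein

open PowerSeries Filter Topology

variable {p : ℕ} [Fact p.Prime]

/-- In `G * C = A`, each coefficient of `G` is that of `A` minus an integral combination of earlier
ones; the ultrametric inequality propagates the bound. -/
theorem norm_coeff_mul_inv_le {A C : PowerSeries ℂ_[p]} {r : ℝ} (hr : 0 ≤ r)
    (hA : ∀ n, ‖coeff n A‖ ≤ r) (hC0 : constantCoeff C = 1) (hC : ∀ n, ‖coeff n C‖ ≤ 1) (n : ℕ) :
    ‖coeff n (A * C⁻¹)‖ ≤ r := by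
  have hmul : A * C⁻¹ * C = A := by
    rw [mul_assoc, PowerSeries.inv_mul_cancel _ (by simp [hC0]), mul_one]
  generalize A * C⁻¹ = G at hmul
  induction n using Nat.strong_induction_on with
  | _ n ih =>
    have h : coeff n G = coeff n A -
        ∑ x ∈ (Finset.HasAntidiagonal.antidiagonal n).erase (n, 0), coeff x.1 G * coeff x.2 C := by
      rw [← hmul, coeff_mul, ← Finset.add_sum_erase _ _ (a := (n, 0)) (by simp)]
      simp [hC0]
    rw [h]
    refine (norm_sub_le_max_complex _ _).trans (max_le (hA n) ?_)
    refine IsUltrametricDist.norm_sum_le_of_forall_le_of_nonneg hr fun x hx => ?_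
    rw [Finset.mem_erase, Finset.HasAntidiagonal.mem_antidiagonal] at hx
    have hlt : x.1 < n := by
      rcases x with ⟨a, d⟩
      rw [Ne, Prod.mk.injEq] at hx
      dsimp only at hx ⊢
      omega
    rw [norm_mul]
    exact (mul_le_of_le_one_right (norm_nonneg _) (hC _)).trans (ih _ hlt)

/-- `E*_κ` is congruent to `1` modulo `w(κ)`. -/
theorem norm_coeff_eisensteinStar_sub_one_le (hp : 5 ≤ p) {k : ℕ} (hk : 0 < k) (hpk : p - 1 ∣ k)
    (n : ℕ) : ‖coeff n (eisensteinStar (powWeight p k) - 1)‖ ≤ ‖(powWeight p k).w‖ := by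
  rw [map_sub, eisensteinStar, coeff_mk, coeff_one]
  split_ifs with hn
  · simp
  · rw [sub_zero, norm_mul, norm_div, norm_zetaStar_powWeight hp hk hpk, norm_two_complex hp,
      one_div, inv_inv]
    refine mul_le_of_le_one_right (norm_nonneg _) ?_
    refine IsUltrametricDist.norm_sum_le_of_forall_le_of_nonneg zero_le_one fun d hd => ?_
    rw [eval_powWeight_mul_inv hk (Finset.mem_filter.1 hd).2, norm_pow]
    exact pow_le_one₀ (norm_nonneg _) (norm_natCast_complex_le_one d)

theorem norm_coeff_V_sub_one_le {f : PowerSeries ℂ_[p]} {r : ℝ} (hr : 0 ≤ r)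
    (hf : ∀ n, ‖coeff n (f - 1)‖ ≤ r) (n : ℕ) : ‖coeff n (V f - 1)‖ ≤ r := by
  have h : V f - 1 = V (f - 1) := by simp [V]
  rw [h, V, coeff_expand]
  split_ifs
  · exact hf _
  · simpa using hr

theorem norm_coeff_quotient_sub_one_le (hp : 5 ≤ p) {k : ℕ} (hk : 0 < k) (hpk : p - 1 ∣ k)
    (hw : ‖(powWeight p k).w‖ ≤ 1) (n : ℕ) :
    ‖coeff n (eisensteinStar (powWeight p k) * (V (eisensteinStar (powWeight p k)))⁻¹) -
      coeff n 1‖ ≤ ‖(powWeight p k).w‖ := by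
  have hE := norm_coeff_eisensteinStar_sub_one_le hp hk hpk
  set f := eisensteinStar (powWeight p k) with hf
  have hV := norm_coeff_V_sub_one_le (norm_nonneg _) hE
  have hV0 : constantCoeff (V f) = 1 := by
    rw [V, constantCoeff_expand, hf, eisensteinStar, ← coeff_zero_eq_constantCoeff_apply, coeff_mk,
      if_pos rfl]
  have h : f * (V f)⁻¹ - 1 = ((f - 1) - (V f - 1)) * (V f)⁻¹ := by
    rw [sub_sub_sub_cancel_right, sub_mul, PowerSeries.mul_inv_cancel _ (by simp [hV0])]
  rw [← map_sub, h]
  refine norm_coeff_mul_inv_le (norm_nonneg _) (fun m => ?_) hV0 (fun m => ?_) n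
  · rw [map_sub]
    exact (norm_sub_le_max_complex _ _).trans (max_le (hE m) (hV m))
  · rw [← sub_add_cancel (V f) 1, map_add]
    refine (IsUltrametricDist.norm_add_le_max _ _).trans (max_le ((hV m).trans hw) ?_)
    rw [coeff_one]
    split_ifs <;> simp

/-- Integrality of the `b j` gives the dominating series `2 ^ (-j)` once `‖w‖ < 1 / 2`; at `w = 0`
only the term `j = 0` survives. -/
theorem tendsto_coeff_beta (b : ℕ → PowerSeries ℤ_[p]) {w : ℕ → ℂ_[p]}
    (hw : Tendsto w atTop (𝓝 0)) (n : ℕ) :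
    Tendsto (fun m => coeff n (beta b (w m))) atTop
      (𝓝 (algebraMap ℚ_[p] ℂ_[p] (coeff n (b 0) : ℤ_[p]))) := by
  simp only [beta, coeff_mk]
  have h : algebraMap ℚ_[p] ℂ_[p] (coeff n (b 0) : ℤ_[p]) =
      ∑' j, algebraMap ℚ_[p] ℂ_[p] (coeff n (b j) : ℤ_[p]) * 0 ^ j := by
    rw [tsum_eq_single 0 fun j hj => by simp [hj]]
    simp
  rw [h]
  refine tendsto_tsum_of_dominated_convergence (bound := fun j => (1 / 2 : ℝ) ^ j)
    summable_geometric_two (fun j => (hw.pow j).const_mul _) ?_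
  have hw' : ∀ᶠ m in atTop, ‖w m‖ < 1 / 2 := by
    have := hw.norm
    rw [norm_zero] at this
    exact this.eventually_lt_const (by norm_num)
  filter_upwards [hw'] with m hm j
  rw [norm_mul, norm_pow, norm_algebraMap']
  refine (mul_le_of_le_one_left (by positivity) (PadicInt.norm_le_one _)).trans ?_
  exact pow_le_pow_left₀ (norm_nonneg _) hm.le j

theorem coeff_beta_eq_zero {b : ℕ → PowerSeries ℤ_[p]} {n : ℕ} (h : ∀ j, coeff n (b j) = 0)
    (w : ℂ_[p]) : coeff n (beta b w) = 0 := by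
  simp [beta, h]

theorem constantCoeff_Epm1_inv : constantCoeff (Epm1 p)⁻¹ = 1 := by
  rw [PowerSeries.constantCoeff_inv]
  simp [Epm1, eisensteinQ, ← coeff_zero_eq_constantCoeff_apply]

/-- The Katz expansion specializes to `1` at the trivial character. -/
theorem sum_coeff_katz_eq_coeff_one (hp : 5 ≤ p) {b : ℕ → ℕ → PowerSeries ℤ_[p]}
    (hb : IsFormalKatzExpansion b) (n : ℕ) :
    ∑ i ∈ Finset.range (12 * n + 13), coeff n ((b i 0).map
      ((algebraMap ℚ_[p] ℂ_[p]).comp PadicInt.Coe.ringHom) * ((Epm1 p)⁻¹) ^ i) = coeff n 1 := by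
  have hlt : (p : ℝ)⁻¹ < 1 := inv_lt_one_of_one_lt₀ (by exact_mod_cast (by omega : 1 < p))
  set κ : ℕ → Weight p := fun m => powWeight p ((p - 1) * p ^ m) with hκ
  have hpow : Tendsto (fun m : ℕ => (p : ℝ)⁻¹ ^ m) atTop (𝓝 0) :=
    tendsto_pow_atTop_nhds_zero_of_lt_one (by positivity) hlt
  have hw : Tendsto (fun m => (κ m).w) atTop (𝓝 0) :=
    squeeze_zero_norm norm_w_powWeight_le hpow
  have hk : ∀ m, 0 < (p - 1) * p ^ m := fun m =>
    Nat.mul_pos (by omega) (Nat.pow_pos (by omega))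
  -- The range is independent of `m`, so the limit can be exchanged with the sum over `i`.
  have hfin : ∀ m, ∑ i ∈ Finset.range (12 * n + 13),
      coeff n (beta (b i) (κ m).w * ((Epm1 p)⁻¹) ^ i) =
      coeff n (eisensteinStar (κ m) * (V (eisensteinStar (κ m)))⁻¹) := by
    intro m
    refine HasSum.unique (hasSum_sum_of_ne_finset_zero fun i hi => ?_)
      (hb.hasSum (κ m) (isTrivialOnRoots_powWeight (dvd_mul_right _ _)) (powWeight_ne_one (hk m)) n)
    rw [Finset.mem_range, not_lt] at hi
    rw [coeff_mul]
    refine Finset.sum_eq_zero fun x hx => ?_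
    rw [Finset.HasAntidiagonal.mem_antidiagonal] at hx
    have hx1 : x.1 < dimM ((i - 1) * (p - 1)) :=
      lt_of_le_of_lt (by omega) (lt_dimM_of_le hp hi)
    rw [coeff_beta_eq_zero fun j => coeff_eq_zero_of_mem_B (by omega) hx1 (hb.mem i j), zero_mul]
  have hlim : Tendsto (fun m => coeff n (eisensteinStar (κ m) * (V (eisensteinStar (κ m)))⁻¹))
      atTop (𝓝 (coeff n 1)) := by
    rw [tendsto_iff_norm_sub_tendsto_zero]
    refine squeeze_zero (fun _ => norm_nonneg _) (fun m => ?_) hpow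
    refine (norm_coeff_quotient_sub_one_le hp (hk m) (dvd_mul_right _ _) ?_ n).trans
      (norm_w_powWeight_le m)
    exact (norm_w_powWeight_le m).trans (pow_le_one₀ (by positivity) hlt.le)
  refine tendsto_nhds_unique ?_ hlim
  simp only [← hfin, coeff_mul]
  refine tendsto_finsetSum _ fun i _ => tendsto_finsetSum _ fun x _ => ?_
  exact (tendsto_coeff_beta (b i) hw x.1).mul_const _

end KatzEisenstein

theorem mainTheorem1 (p : ℕ) [Fact p.Prime] (hp : 5 ≤ p)
    (b : ℕ → ℕ → PowerSeries ℤ_[p]) (hb : KatzEisenstein.IsFormalKatzExpansion b) :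
    b 0 0 = 1 ∧ ∀ i : ℕ, 0 < i → b i 0 = 0 := by
  -- Uniqueness applies to the difference from the trivial expansion of `1`, whose only term is `1 ∈
  -- B_0`.
  have hc := KatzEisenstein.eq_zero_of_sum_eq_zero hp
    ((algebraMap ℚ_[p] ℂ_[p]).comp PadicInt.Coe.ringHom)
    ((algebraMap ℚ_[p] ℂ_[p]).injective.comp Subtype.val_injective)
    KatzEisenstein.constantCoeff_Epm1_inv (c := fun i => b i 0 - if i = 0 then 1 else 0) ?_ ?_
  · refine ⟨sub_eq_zero.1 (by simpa using hc 0), fun i hi => by simpa [hi.ne'] using hc i⟩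
  · intro i
    refine Submodule.sub_mem _ (hb.mem i 0) ?_
    split_ifs with hi
    · rw [KatzEisenstein.B, if_pos hi]
      exact Submodule.mem_span_singleton_self 1
    · exact Submodule.zero_mem _
  · intro n
    simp only [map_sub, sub_mul, Finset.sum_sub_distrib]
    rw [KatzEisenstein.sum_coeff_katz_eq_coeff_one hp hb, sub_eq_zero, Finset.sum_eq_single 0]
    · simp
    · intro i _ hi
      simp [hi]
    · simp
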